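/- For a group $G$ let $C^k_b(G;\mathbb{R})$ be the real vector space of all functions $f:G^k\to\mathbb{R}$ with bounded range, with coboundary $$\delta f(g_0,\dots,g_k)=f(g_1,\dots,g_k)+\sum_{i=1}^{k}(-1)^i f(g_0,\dots,g_{i-1}g_i,\dots,g_k)+(-1)^{k+1}f(g_0,\dots,g_{k-1}),$$ and let $H^k_b(G;\mathbb{R})$ be the $k$-th cohomology of this complex (the bounded cohomology of $G$). Theorem. Let $A$ be a group, let $C, D\le A$ be subgroups, let $\varphi:C\to D$ be an isomorphism, and let $G=A*_C\varphi=\langle A,t \mid tct^{-1}=\varphi(c)\ \text{for all } c\in C\rangle$ be the corresponding HNN extension. Suppose that $|A/C|\ge 2$ and $|A/\varphi(C)|\ge 2$ (the indices may be infinite). Then the dimension of $H^2_b(G;\mathbb{R})$ as a vector space over $\mathbb{R}$ is at least the cardinality of the continuum. If moreover $A$ is countable (equivalently, $G$ is countable; $G$ need not be finitely generated), then this dimension is exactly the cardinality of the continuum. -/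

import Mathlib

open scoped Cardinal

universe u

namespace BoundedCohomology

/-- The inhomogeneous coboundary on all real-valued cochains of a group (trivial coefficients):
`δf(g₀,…,gₖ) = f(g₁,…,gₖ) + ∑_{i=1}^{k} (-1)^i f(g₀,…,g_{i-1}gᵢ,…,gₖ) + (-1)^{k+1} f(g₀,…,g_{k-1})`.
For `i : Fin k`, `Fin.contractNth i.castSucc (· * ·) g` multiplies the entries of (zero-based)
index `i` and `i + 1` of `g`. -/
def coboundary (G : Type u) [Group G] (k : ℕ) :
    ((Fin k → G) → ℝ) →ₗ[ℝ] ((Fin (k + 1) → G) → ℝ) where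
  toFun f g :=
    f (fun i => g i.succ)
      + ∑ i : Fin k, (-1 : ℝ) ^ ((i : ℕ) + 1) * f (Fin.contractNth i.castSucc (· * ·) g)
      + (-1 : ℝ) ^ (k + 1) * f (fun i => g i.castSucc)
  map_add' f f' := by
    ext g
    simp only [Pi.add_apply, mul_add, Finset.sum_add_distrib]
    ring
  map_smul' r f := by
    ext g
    simp only [Pi.smul_apply, smul_eq_mul, RingHom.id_apply, mul_add, Finset.mul_sum]
    congr 1
    · congr 1
      exact Finset.sum_congr rfl fun i _ => by ring
    · ring

/-- `C^k_b(G; ℝ)`: the real vector space of functions `G^k → ℝ` with bounded range. -/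
def boundedCochains (G : Type u) (k : ℕ) : Submodule ℝ ((Fin k → G) → ℝ) where
  carrier := {f | ∃ M : ℝ, ∀ g, |f g| ≤ M}
  add_mem' := by
    rintro f f' ⟨M, hM⟩ ⟨M', hM'⟩
    exact ⟨M + M', fun g => (abs_add_le _ _).trans (add_le_add (hM g) (hM' g))⟩
  zero_mem' := ⟨0, fun g => by simp⟩
  smul_mem' := by
    rintro r f ⟨M, hM⟩
    refine ⟨|r| * M, fun g => ?_⟩
    rw [Pi.smul_apply, smul_eq_mul, abs_mul]
    exact mul_le_mul_of_nonneg_left (hM g) (abs_nonneg r)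

theorem coboundary_mem_boundedCochains (G : Type u) [Group G] (k : ℕ)
    (f : (Fin k → G) → ℝ) (hf : f ∈ boundedCochains G k) :
    coboundary G k f ∈ boundedCochains G (k + 1) := by
  obtain ⟨M, hM⟩ := hf
  have key : ∀ (n : ℕ) (x : Fin k → G), |(-1 : ℝ) ^ n * f x| ≤ M := fun n x => by
    rw [abs_mul, abs_pow, abs_neg, abs_one, one_pow, one_mul]
    exact hM x
  refine ⟨M + ∑ _i : Fin k, M + M, fun g => ?_⟩
  refine (abs_add_le _ _).trans (add_le_add ((abs_add_le _ _).trans (add_le_add (hM _) ?_)) (key _ _))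
  exact (Finset.abs_sum_le_sum_abs _ _).trans (Finset.sum_le_sum fun i _ => key _ _)

theorem coboundary_coboundary (G : Type u) [Group G] (k : ℕ) (f : (Fin k → G) → ℝ) :
    coboundary G (k + 1) (coboundary G k f) = 0 := by
  let K := ULift.{u} ℝ
  let R := Rep.trivial K G K
  have hd : ∀ (n : ℕ) (f : (Fin n → G) → ℝ),
      (inhomogeneousCochains.d R n).hom (fun x => (ULift.up (f x) : K))
        = fun g => (ULift.up (coboundary G n f g) : K) := by
    intro n f
    funext g
    have h : Fin.contractNth (Fin.last n) (· * ·) g = fun i => g i.castSucc := by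
      funext i
      rw [Fin.contractNth_apply_of_lt]
      exact i.isLt
    change ULift.up (f (fun i => g i.succ)) + ∑ j : Fin (n + 1),
      (-1 : K) ^ ((j : ℕ) + 1) • ULift.up (f (Fin.contractNth j (· * ·) g)) = _
    apply ULift.down_injective
    rw [Fin.sum_univ_castSucc, ← add_assoc, h]
    have hs : ∀ (m : ℕ) (F : Fin m → K), (∑ j, F j).down = ∑ j, (F j).down := fun m F =>
      map_sum (ULift.ringEquiv : K ≃+* ℝ) F Finset.univ
    simp only [ULift.add_down, hs]
    have hp : ∀ (m : ℕ) (x : ℝ), ((-1 : K) ^ m • (ULift.up x : K)).down = (-1 : ℝ) ^ m * x :=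
      fun m x => rfl
    simp only [hp]
    rfl
  have h2 := congrArg (fun m => m.hom (fun x => (ULift.up (f x) : K)))
    (groupCohomology.inhomogeneousCochains.d_comp_d (A := R) (n := k))
  have h3 : (inhomogeneousCochains.d R (k + 1)).hom
      ((inhomogeneousCochains.d R k).hom (fun x => (ULift.up (f x) : K))) = 0 := h2
  rw [hd, hd] at h3
  funext g
  exact congrArg ULift.down (congrFun h3 g)

/-- Bounded `k`-cocycles: the kernel of `δ : C^k_b(G; ℝ) → C^{k+1}_b(G; ℝ)`. -/
def boundedCocycles (G : Type u) [Group G] (k : ℕ) : Submodule ℝ ((Fin k → G) → ℝ) :=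
  boundedCochains G k ⊓ LinearMap.ker (coboundary G k)

/-- Bounded `k`-coboundaries: the image of `δ : C^{k-1}_b(G; ℝ) → C^k_b(G; ℝ)`, i.e. the
coboundaries of *bounded* cochains (zero for `k = 0`). -/
def boundedCoboundaries (G : Type u) [Group G] : (k : ℕ) → Submodule ℝ ((Fin k → G) → ℝ)
  | 0 => ⊥
  | k + 1 => (boundedCochains G k).map (coboundary G k)

theorem boundedCoboundaries_le_boundedCocycles (G : Type u) [Group G] (k : ℕ) :
    boundedCoboundaries G k ≤ boundedCocycles G k := by
  cases k with
  | zero => exact bot_le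
  | succ k =>
    rintro _ ⟨f, hf, rfl⟩
    exact ⟨coboundary_mem_boundedCochains G k f hf, coboundary_coboundary G k f⟩

/-- The `k`-th bounded cohomology `H^k_b(G; ℝ)` of the (discrete) group `G` with trivial real
coefficients: bounded cocycles modulo the coboundaries of bounded cochains. -/
abbrev Cohomology (G : Type u) [Group G] (k : ℕ) : Type u :=
  boundedCocycles G k ⧸ (boundedCoboundaries G k).submoduleOf (boundedCocycles G k)

end BoundedCohomology

/-! By Britton's lemma an element of the HNN extension determines the exponent sequence of the
stable letter in a reduced word (`signs`). In a product only a final piece `q` and its inverse `bar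
q` cancel (`exists_signs_mul`). Hence an odd function of sign sequences that is almost additive
under concatenation gives a quasimorphism; `oddRunSum α` is one for every bounded `α`.

On the powers of `t ^ (n + 1) * a * t⁻¹ ^ (m + 1) * b`, with `a ∉ C` and `b ∉ D`, this quasimorphism
grows linearly with slope `2 * (α (n + 1) - α (m + 1))`. If its class vanishes, a homomorphism has
these slopes, and boundedness of `α` makes `α` constant on the positive integers
(`eq_of_runQuasimorphism_sub_bounded`). The geometric sequences are independent modulo such
sequences, so they give continuum many independent classes. For countable `A`, counting cochains
gives the upper bound. -/

namespace SignList

/-! ### Almost additive functions of sign sequences -/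

/-- The sequence of signs of the inverse: reverse the list and negate its entries. -/
def bar (l : List ℤˣ) : List ℤˣ := (l.map (fun u => -u)).reverse

theorem bar_bar (l : List ℤˣ) : bar (bar l) = l := by
  simp [bar]

theorem bar_append (l l' : List ℤˣ) : bar (l ++ l') = bar l' ++ bar l := by
  simp [bar]

/-- The number of leading entries of `l` that are equal to `u`. -/
def lead (u : ℤˣ) : List ℤˣ → ℕ
  | [] => 0
  | v :: l => if v = u then lead u l + 1 else 0

/-- The sum of `u * (α n - α 0)` over the maximal runs `u, …, u` of `l`, of length `n`. -/
def runSum (α : ℕ → ℝ) : List ℤˣ → ℝ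
  | [] => 0
  | u :: l => ((u : ℤ) : ℝ) * (α (lead u l + 1) - α (lead u l)) + runSum α l

theorem lead_replicate_append (u : ℤˣ) (n : ℕ) (l : List ℤˣ) :
    lead u (List.replicate n u ++ l) = n + lead u l := by
  induction n with
  | zero => simp
  | succ n ih => simp [List.replicate_succ, lead, ih]; ring

/-- The letterwise increments telescope along a run. -/
theorem runSum_replicate_append (α : ℕ → ℝ) (u : ℤˣ) (n : ℕ) (l : List ℤˣ) :
    runSum α (List.replicate n u ++ l)
      = ((u : ℤ) : ℝ) * (α (n + lead u l) - α (lead u l)) + runSum α l := by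
  induction n with
  | zero => simp
  | succ n ih =>
    rw [List.replicate_succ, List.cons_append, runSum, lead_replicate_append, ih,
      show n + 1 + lead u l = n + lead u l + 1 by ring]
    ring

theorem lead_append_of_ne (u : ℤˣ) (l l' : List ℤˣ) (h : ∃ v ∈ l, v ≠ u) :
    lead u (l ++ l') = lead u l := by
  induction l with
  | nil => simp at h
  | cons v l ih =>
    by_cases hv : v = u
    · have : ∃ w ∈ l, w ≠ u := by
        obtain ⟨w, hw, hwu⟩ := h
        rcases List.mem_cons.1 hw with rfl | hw
        · exact absurd hv hwu
        · exact ⟨w, hw, hwu⟩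
      simp [lead, hv, ih this]
    · simp [lead, hv]

theorem abs_units_mul (u : ℤˣ) (x : ℝ) : |((u : ℤ) : ℝ) * x| = |x| := by
  rcases Int.units_eq_one_or u with rfl | rfl <;> simp

/-- Only the run crossing the cut is affected: letters before the last run of `p` contribute the
same in `p` and `p ++ r`. Once `p` is a single run, the error is a signed sum of four values of `α`.
-/
theorem abs_runSum_append_sub_le (α : ℕ → ℝ) (M : ℝ) (hM : ∀ n, |α n| ≤ M) (p r : List ℤˣ) :
    |runSum α (p ++ r) - runSum α p - runSum α r| ≤ 4 * M := by
  induction p with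
  | nil =>
    have := (abs_nonneg _).trans (hM 0)
    simp [runSum]
    linarith
  | cons u p ih =>
    by_cases h : ∃ v ∈ p, v ≠ u
    · rw [List.cons_append, runSum, runSum, lead_append_of_ne u p r h]
      convert ih using 2
      ring
    · push Not at h
      have hp : u :: p = List.replicate (p.length + 1) u := by
        rw [List.replicate_succ, ← List.eq_replicate_of_mem h]
      have h1 := runSum_replicate_append α u (p.length + 1) []
      rw [List.append_nil] at h1
      rw [hp, runSum_replicate_append, h1]
      simp only [lead, runSum]
      rw [show ∀ a b c d e x : ℝ, x * (a - b) + c - (x * (d - e) + 0) - c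
        = x * (a - b - d + e) by intros; ring, abs_units_mul]
      have h1 := abs_le.1 (hM (p.length + 1 + lead u r))
      have h2 := abs_le.1 (hM (lead u r))
      have h3 := abs_le.1 (hM (p.length + 1 + 0))
      have h4 := abs_le.1 (hM 0)
      rw [abs_le]
      constructor <;> linarith

/-- The antisymmetrization of `runSum` with respect to `bar`. -/
def oddRunSum (α : ℕ → ℝ) (l : List ℤˣ) : ℝ := runSum α l - runSum α (bar l)

theorem oddRunSum_bar (α : ℕ → ℝ) (l : List ℤˣ) : oddRunSum α (bar l) = -oddRunSum α l := by
  simp [oddRunSum, bar_bar]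

theorem abs_oddRunSum_append_sub_le (α : ℕ → ℝ) (M : ℝ) (hM : ∀ n, |α n| ≤ M)
    (p r : List ℤˣ) :
    |oddRunSum α (p ++ r) - oddRunSum α p - oddRunSum α r| ≤ 8 * M := by
  have h1 := abs_le.1 (abs_runSum_append_sub_le α M hM p r)
  have h2 := abs_le.1 (abs_runSum_append_sub_le α M hM (bar r) (bar p))
  rw [oddRunSum, oddRunSum, oddRunSum, bar_append, abs_le]
  constructor <;> linarith

theorem runSum_add (α β : ℕ → ℝ) (l : List ℤˣ) :
    runSum (α + β) l = runSum α l + runSum β l := by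
  induction l with
  | nil => simp [runSum]
  | cons u l ih => simp only [runSum, ih, Pi.add_apply]; ring

theorem runSum_smul (c : ℝ) (α : ℕ → ℝ) (l : List ℤˣ) :
    runSum (c • α) l = c * runSum α l := by
  induction l with
  | nil => simp [runSum]
  | cons u l ih => simp only [runSum, ih, Pi.smul_apply, smul_eq_mul]; ring

/-- The sequence of signs consisting of `k` copies of `n` times `1` and `m` times `-1`. -/
def zigzag (n m k : ℕ) : List ℤˣ :=
  (List.replicate k (List.replicate n (1 : ℤˣ) ++ List.replicate m (-1 : ℤˣ))).flatten

theorem bar_zigzag (n m k : ℕ) : bar (zigzag n m k) = zigzag m n k := by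
  simp [bar, zigzag, List.reverse_flatten]

theorem lead_neg_one_zigzag (n m k : ℕ) : lead (-1) (zigzag (n + 1) m k) = 0 := by
  cases k with
  | zero => simp [zigzag, lead]
  | succ k =>
    have : (1 : ℤˣ) ≠ -1 := by decide
    simp [zigzag, List.replicate_succ, lead, this]

theorem runSum_zigzag (α : ℕ → ℝ) (n m k : ℕ) :
    runSum α (zigzag (n + 1) (m + 1) k) = k * (α (n + 1) - α (m + 1)) := by
  induction k with
  | zero => simp [zigzag, runSum]
  | succ k ih =>
    have h : zigzag (n + 1) (m + 1) (k + 1) = List.replicate (n + 1) (1 : ℤˣ)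
        ++ (List.replicate (m + 1) (-1 : ℤˣ) ++ zigzag (n + 1) (m + 1) k) := by
      simp [zigzag, List.replicate_succ]
    have h2 : lead 1 (List.replicate (m + 1) (-1 : ℤˣ) ++ zigzag (n + 1) (m + 1) k) = 0 := by
      have : (-1 : ℤˣ) ≠ 1 := by decide
      simp [List.replicate_succ, lead, this]
    rw [h, runSum_replicate_append, runSum_replicate_append, h2, lead_neg_one_zigzag, ih]
    push_cast
    simp only [add_zero]
    ring

/-- Inversion swaps the two run lengths, so antisymmetrizing doubles the value instead of killing
it. -/
theorem oddRunSum_zigzag (α : ℕ → ℝ) (n m k : ℕ) :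
    oddRunSum α (zigzag (n + 1) (m + 1) k) = k * (2 * (α (n + 1) - α (m + 1))) := by
  rw [oddRunSum, bar_zigzag, runSum_zigzag, runSum_zigzag]
  ring

end SignList

/-! ### Exponent sequences of reduced words -/

namespace HNNExtension

open NormalWord SignList

variable {A : Type u} [Group A] {C D : Subgroup A} (φ : C ≃* D)

/-- The product of the syllables `t ^ u * a`, for `(u, a)` in a list. -/
def syllableProd (l : List (ℤˣ × A)) : HNNExtension A C D φ :=
  (l.map (fun x => t ^ (x.1 : ℤ) * of x.2)).prod

theorem syllableProd_append (l l' : List (ℤˣ × A)) :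
    syllableProd φ (l ++ l') = syllableProd φ l * syllableProd φ l' := by
  simp [syllableProd]

theorem syllableProd_cons (x : ℤˣ × A) (l : List (ℤˣ × A)) :
    syllableProd φ (x :: l) = t ^ (x.1 : ℤ) * of x.2 * syllableProd φ l := by
  simp [syllableProd]

variable (C D) in
/-- A list of syllables is reduced if it has no subword `t ^ u * a * t ^ (-u)` with `a` in the
associated subgroup. -/
def IsReducedList (l : List (ℤˣ × A)) : Prop :=
  l.IsChain (fun a b => a.2 ∈ toSubgroup C D a.1 → a.1 = b.1)

theorem exists_reducedWord_prod_eq (g : HNNExtension A C D φ) :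
    ∃ w : ReducedWord A C D, w.prod φ = g := by
  obtain ⟨d⟩ := TransversalPair.nonempty A C D
  exact ⟨_, (NormalWord.equiv φ d).left_inv g⟩

/-- The sequence of exponents of the stable letter in a reduced word for `g`. -/
noncomputable def signs (g : HNNExtension A C D φ) : List ℤˣ :=
  (exists_reducedWord_prod_eq φ g).choose.toList.map Prod.fst

/-- Britton's lemma: the choice of reduced word in `signs` does not matter. -/
theorem signs_eq (a : A) (l : List (ℤˣ × A)) (hl : IsReducedList C D l) :
    signs φ (of a * syllableProd φ l) = l.map Prod.fst :=
  (ReducedWord.map_fst_eq_and_of_prod_eq φ (w₂ := ⟨a, l, hl⟩)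
    (exists_reducedWord_prod_eq φ _).choose_spec).1

theorem exists_syllableProd_eq (g : HNNExtension A C D φ) :
    ∃ (a : A) (l : List (ℤˣ × A)), IsReducedList C D l ∧ g = of a * syllableProd φ l := by
  obtain ⟨w, rfl⟩ := exists_reducedWord_prod_eq φ g
  exact ⟨w.head, w.toList, w.chain, rfl⟩

theorem zpow_mul_of_mul_zpow_neg (u : ℤˣ) (a : A) (ha : a ∈ toSubgroup C D u) :
    ∃ b : A, (t ^ (u : ℤ) * of a * t ^ ((-u : ℤˣ) : ℤ) : HNNExtension A C D φ) = of b := by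
  rcases Int.units_eq_one_or u with rfl | rfl
  · exact ⟨φ ⟨a, ha⟩, by rw [equiv_eq_conj]; simp⟩
  · exact ⟨φ.symm ⟨a, ha⟩, by rw [equiv_symm_eq_conj]; simp⟩

/-- No stable letter follows the last base-group element, so nothing constrains it. -/
theorem isReducedList_replace_last {l : List (ℤˣ × A)} {u : ℤˣ} {x : A}
    (h : IsReducedList C D (l ++ [(u, x)])) (y : A) : IsReducedList C D (l ++ [(u, y)]) := by
  rw [IsReducedList, List.isChain_append] at h ⊢
  refine ⟨h.1, List.isChain_singleton _, fun a ha b hb => ?_⟩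
  have := h.2.2 a ha (u, x) (by simp)
  simp only [List.head?_cons, Option.mem_def, Option.some.injEq] at hb
  subst hb
  exact this

/-- The signs of `g`, `h` and `g * h` form a tripod. -/
theorem exists_signs_mul_of_isReducedList (l : List (ℤˣ × A)) :
    ∀ (l' : List (ℤˣ × A)) (a b : A), IsReducedList C D l → IsReducedList C D l' →
      ∃ p q r : List ℤˣ, l.map Prod.fst = p ++ q ∧ l'.map Prod.fst = bar q ++ r ∧
        signs φ ((of a * syllableProd φ l) * (of b * syllableProd φ l')) = p ++ r := by
  induction l using List.reverseRecOn with
  | nil =>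
    intro l' a b _ hl'
    refine ⟨[], [], l'.map Prod.fst, rfl, rfl, ?_⟩
    rw [show (of a * syllableProd φ []) * (of b * syllableProd φ l')
      = of (a * b) * syllableProd φ l' by simp [syllableProd, mul_assoc], signs_eq φ _ _ hl']
    rfl
  | append_singleton l s ih =>
    obtain ⟨u, x⟩ := s
    intro l' a b hl hl'
    have key : (of a * syllableProd φ (l ++ [(u, x)])) * (of b * syllableProd φ l')
        = of a * syllableProd φ (l ++ [(u, x * b)] ++ l') := by
      simp [syllableProd, mul_assoc]
    -- Either there is a pinch at the junction, which collapses to `c`, is absorbed into `y` and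
    -- adds `u` to the cancelled part, or the concatenation is already reduced.
    by_cases hc : x * b ∈ toSubgroup C D u ∧ ∃ y l'', l' = (-u, y) :: l''
    · obtain ⟨hx, y, l'', rfl⟩ := hc
      obtain ⟨c, hcc⟩ := zpow_mul_of_mul_zpow_neg φ u (x * b) hx
      obtain ⟨p, q, r, h1, h2, h3⟩ := ih l'' a (c * y) (List.isChain_append.1 hl).1
        (List.isChain_cons.1 hl').2
      refine ⟨p, q ++ [u], r, by simp [h1], by simp [h2, bar], ?_⟩
      rw [← h3, key]
      congr 1
      rw [syllableProd_append, syllableProd_append, syllableProd_cons, map_mul of c, ← hcc]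
      simp [syllableProd, mul_assoc]
    · refine ⟨(l ++ [(u, x)]).map Prod.fst, [], l'.map Prod.fst, by simp, by simp [bar], ?_⟩
      rw [key, signs_eq]
      · simp
      · rw [IsReducedList, List.isChain_append]
        refine ⟨isReducedList_replace_last hl _, hl', fun a ha s hs hm => ?_⟩
        simp only [List.getLast?_append, List.getLast?_singleton, Option.some_or, Option.mem_def,
          Option.some.injEq] at ha
        subst ha
        obtain ⟨v, y⟩ := s
        by_contra hne
        refine hc ⟨hm, y, l'.tail, ?_⟩
        have hv : v = -u := by
          rw [← Int.units_ne_iff_eq_neg]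
          exact fun h => hne h.symm
        rw [← hv]
        exact List.eq_cons_of_mem_head? hs

theorem exists_signs_mul (g h : HNNExtension A C D φ) :
    ∃ p q r : List ℤˣ, signs φ g = p ++ q ∧ signs φ h = bar q ++ r ∧
      signs φ (g * h) = p ++ r := by
  obtain ⟨a, l, hl, rfl⟩ := exists_syllableProd_eq φ g
  obtain ⟨b, l', hl', rfl⟩ := exists_syllableProd_eq φ h
  rw [signs_eq φ _ _ hl, signs_eq φ _ _ hl']
  exact exists_signs_mul_of_isReducedList φ l l' a b hl hl'

theorem isReducedList_run_append (u : ℤˣ) (x : A) (hx : x ∉ toSubgroup C D u) (n : ℕ)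
    (l : List (ℤˣ × A)) (hl : IsReducedList C D l) :
    IsReducedList C D (List.replicate n (u, 1) ++ (u, x) :: l) := by
  induction n with
  | zero =>
    exact List.isChain_cons.2 ⟨fun y _ h => absurd h hx, hl⟩
  | succ n ih =>
    rw [List.replicate_succ, List.cons_append]
    refine List.isChain_cons.2 ⟨fun y hy _ => ?_, ih⟩
    cases n with
    | zero => simp at hy; subst hy; rfl
    | succ n => simp [List.replicate_succ] at hy; subst hy; rfl

/-- The exponent changes sign only across `a` after `t` and across `b` after `t⁻¹`; `a ∉ C` and `b ∉
D` exclude pinches there. -/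
theorem signs_pow_zigzag (a b : A) (ha : a ∉ C) (hb : b ∉ D) (n m k : ℕ) :
    signs φ ((t ^ (n + 1) * of a * (t⁻¹ ^ (m + 1) * of b)) ^ k) = zigzag (n + 1) (m + 1) k := by
  suffices h : ∃ l, IsReducedList C D l ∧ l.map Prod.fst = zigzag (n + 1) (m + 1) k ∧
      syllableProd φ l = (t ^ (n + 1) * of a * (t⁻¹ ^ (m + 1) * of b)) ^ k by
    obtain ⟨l, h1, h2, h3⟩ := h
    rw [← h3, ← h2, ← signs_eq φ 1 l h1, map_one, one_mul]
  induction k with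
  | zero => exact ⟨[], List.isChain_nil, by simp [zigzag], by simp [syllableProd]⟩
  | succ k ih =>
    obtain ⟨l, h1, h2, h3⟩ := ih
    refine ⟨List.replicate n (1, 1) ++ (1, a) :: (List.replicate m (-1, 1) ++ (-1, b) :: l),
      isReducedList_run_append 1 a ha n _ (isReducedList_run_append (-1 : ℤˣ) b (by simpa using hb) m _ h1), ?_, ?_⟩
    · rw [zigzag, List.replicate_succ, List.flatten_cons, ← zigzag]
      simp [h2, List.replicate_succ']
    · rw [pow_succ', ← h3]
      simp [syllableProd, pow_succ, mul_assoc]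

/-! ### Run quasimorphisms and their distance from homomorphisms -/

/-- The quasimorphism of an HNN extension obtained by summing `u * (α n - α 0)` over the maximal
runs of equal exponents `u` in a reduced word, with `n` the length of the run. -/
noncomputable def runQuasimorphism (α : ℕ → ℝ) (g : HNNExtension A C D φ) : ℝ :=
  oddRunSum α (signs φ g)

theorem abs_runQuasimorphism_defect_le (α : ℕ → ℝ) (M : ℝ) (hM : ∀ n, |α n| ≤ M)
    (g h : HNNExtension A C D φ) :
    |runQuasimorphism φ α h - runQuasimorphism φ α (g * h) + runQuasimorphism φ α g|
      ≤ 24 * M := by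
  -- The values on `q` and `bar q` cancel by oddness, leaving three concatenation errors of at most
  -- `8 * M` each.
  obtain ⟨p, q, r, h1, h2, h3⟩ := exists_signs_mul φ g h
  rw [runQuasimorphism, runQuasimorphism, runQuasimorphism, h1, h2, h3]
  have e1 := abs_le.1 (abs_oddRunSum_append_sub_le α M hM p q)
  have e2 := abs_le.1 (abs_oddRunSum_append_sub_le α M hM (bar q) r)
  have e3 := abs_le.1 (abs_oddRunSum_append_sub_le α M hM p r)
  rw [oddRunSum_bar] at e2
  rw [abs_le]
  constructor <;> linarith

end HNNExtension

theorem eq_zero_of_forall_nat_mul_abs_le {x B : ℝ} (h : ∀ k : ℕ, |k * x| ≤ B) : x = 0 := by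
  by_contra hx
  obtain ⟨k, hk⟩ := exists_nat_gt (B / |x|)
  have := h k
  rw [abs_mul, Nat.abs_cast] at this
  rw [div_lt_iff₀ (abs_pos.2 hx)] at hk
  linarith

namespace HNNExtension

open SignList

variable {A : Type u} [Group A] {C D : Subgroup A} (φ : C ≃* D)

/-- If the run quasimorphism of a bounded `α` is at bounded distance from a homomorphism, then
`α` is constant on the positive integers. -/
theorem eq_of_runQuasimorphism_sub_bounded (hC : ∃ a, a ∉ C) (hD : ∃ b, b ∉ D)
    (α : ℕ → ℝ) (M : ℝ) (hM : ∀ n, |α n| ≤ M) (h : HNNExtension A C D φ → ℝ)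
    (hmul : ∀ x y, h (x * y) = h x + h y) (B : ℝ)
    (hB : ∀ x, |runQuasimorphism φ α x - h x| ≤ B) (n : ℕ) : α (n + 1) = α 1 := by
  obtain ⟨a, ha⟩ := hC
  obtain ⟨b, hb⟩ := hD
  have hone : h 1 = 0 := by
    have := hmul 1 1
    rw [one_mul] at this
    linarith
  have hpow : ∀ x (k : ℕ), h (x ^ k) = k * h x := by
    intro x k
    induction k with
    | zero => simp [hone]
    | succ k ih => rw [pow_succ, hmul, ih]; push_cast; ring
  have hinv : h t⁻¹ = -h t := by
    have := hmul t t⁻¹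
    rw [mul_inv_cancel, hone] at this
    linarith
  -- Along powers of one element both functions are exactly linear, so bounded distance forces equal
  -- slopes.
  have key : ∀ n m : ℕ,
      2 * (α (n + 1) - α (m + 1)) = ((n : ℝ) - m) * h t + (h (of a) + h (of b)) := by
    intro n m
    have e : h (t ^ (n + 1) * of a * (t⁻¹ ^ (m + 1) * of b))
        = ((n : ℝ) - m) * h t + (h (of a) + h (of b)) := by
      simp only [hmul, hpow, hinv]
      push_cast
      ring
    rw [← e, ← sub_eq_zero]
    refine eq_zero_of_forall_nat_mul_abs_le (B := B) fun k => ?_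
    have := hB ((t ^ (n + 1) * of a * (t⁻¹ ^ (m + 1) * of b)) ^ k)
    rwa [runQuasimorphism, signs_pow_zigzag φ a b ha hb, oddRunSum_zigzag, hpow,
      ← mul_sub] at this
  have h0 := key 0 0
  have hs : h (of a) + h (of b) = 0 := by
    simpa using h0.symm
  -- By `key k 0`, `k * h t` is `2 * (α (k + 1) - α 1)`, which is bounded in `k`.
  have ht : h t = 0 := by
    refine eq_zero_of_forall_nat_mul_abs_le (B := 4 * M) fun k => ?_
    have h1 := key k 0
    rw [hs] at h1
    have h2 := abs_le.1 (hM (k + 1))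
    have h3 := abs_le.1 (hM (0 + 1))
    rw [abs_le]
    push_cast at h1
    constructor <;> linarith
  have := key n 0
  rw [hs, ht] at this
  simp only [mul_zero, add_zero, zero_add] at this
  linarith

end HNNExtension

/-! ### Independent classes and the dimension -/

namespace BoundedCohomology

open HNNExtension

theorem coboundary_one_apply (G : Type u) [Group G] (f : (Fin 1 → G) → ℝ) (g : Fin 2 → G) :
    coboundary G 1 f g
      = f (fun _ => g 1) - f (fun _ => g 0 * g 1) + f (fun _ => g 0) := by
  have h1 : (fun i : Fin 1 => g i.succ) = fun _ => g 1 := by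
    funext i; fin_cases i; rfl
  have h2 : (fun i : Fin 1 => g i.castSucc) = fun _ => g 0 := by
    funext i; fin_cases i; rfl
  have h3 : Fin.contractNth (Fin.castSucc (0 : Fin 1)) (· * ·) g = fun _ => g 0 * g 1 := by
    funext i; fin_cases i; rfl
  change f (fun i => g i.succ) + ∑ i : Fin 1, _ + _ = _
  rw [Fin.sum_univ_one, h1, h2, h3]
  norm_num
  ring

/-- The space of bounded real sequences. -/
def boundedSequences : Submodule ℝ (ℕ → ℝ) where
  carrier := {α | ∃ M : ℝ, ∀ n, |α n| ≤ M}
  add_mem' := by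
    rintro α β ⟨M, hM⟩ ⟨N, hN⟩
    exact ⟨M + N, fun n => (abs_add_le _ _).trans (add_le_add (hM n) (hN n))⟩
  zero_mem' := ⟨0, fun n => by simp⟩
  smul_mem' := by
    rintro c α ⟨M, hM⟩
    refine ⟨|c| * M, fun n => ?_⟩
    rw [Pi.smul_apply, smul_eq_mul, abs_mul]
    exact mul_le_mul_of_nonneg_left (hM n) (abs_nonneg c)

variable {A : Type u} [Group A] {C D : Subgroup A} (φ : C ≃* D)

/-- The run quasimorphism of `α` as a `1`-cochain. -/
noncomputable def runCochain : (ℕ → ℝ) →ₗ[ℝ] ((Fin 1 → HNNExtension A C D φ) → ℝ) where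
  toFun α g := runQuasimorphism φ α (g 0)
  map_add' α β := by
    funext g
    simp only [runQuasimorphism, SignList.oddRunSum, SignList.runSum_add, Pi.add_apply]
    ring
  map_smul' c α := by
    funext g
    simp only [runQuasimorphism, SignList.oddRunSum, SignList.runSum_smul, Pi.smul_apply,
      smul_eq_mul, RingHom.id_apply]
    ring

theorem coboundary_runCochain_mem (α : ℕ → ℝ) (hα : α ∈ boundedSequences) :
    coboundary _ 1 (runCochain φ α) ∈ boundedCocycles (HNNExtension A C D φ) 2 := by
  obtain ⟨M, hM⟩ := hα
  refine ⟨⟨24 * M, fun g => ?_⟩, coboundary_coboundary _ 1 _⟩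
  rw [coboundary_one_apply]
  exact abs_runQuasimorphism_defect_le φ α M hM (g 0) (g 1)

/-- The bounded cohomology class of the coboundary of the run quasimorphism of a bounded
sequence. -/
noncomputable def runClass :
    boundedSequences →ₗ[ℝ] Cohomology (HNNExtension A C D φ) 2 :=
  (Submodule.mkQ _).comp
    (((coboundary _ 1).comp ((runCochain φ).comp boundedSequences.subtype)).codRestrict
      (boundedCocycles (HNNExtension A C D φ) 2)
      fun α => coboundary_runCochain_mem φ α.1 α.2)

/-- If the class is trivial, subtracting a bounded primitive `f` from the quasimorphism leaves a
cochain with zero coboundary, that is, a homomorphism. -/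
theorem eq_of_runClass_eq_zero (hC : ∃ a, a ∉ C) (hD : ∃ b, b ∉ D) (α : boundedSequences)
    (hα : runClass φ α = 0) (n : ℕ) : α.1 (n + 1) = α.1 1 := by
  obtain ⟨M, hM⟩ := α.2
  rw [runClass, LinearMap.comp_apply, Submodule.mkQ_apply, Submodule.Quotient.mk_eq_zero] at hα
  obtain ⟨f, ⟨B, hB⟩, hf⟩ :
    ∃ f ∈ boundedCochains (HNNExtension A C D φ) 1,
      coboundary _ 1 f = coboundary _ 1 (runCochain φ α.1) := hα
  refine eq_of_runQuasimorphism_sub_bounded φ hC hD α.1 M hM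
    (fun x => runQuasimorphism φ α.1 x - f fun _ => x) (fun x y => ?_) B (fun x => ?_) n
  · have h := congrFun hf ![x, y]
    rw [coboundary_one_apply, coboundary_one_apply] at h
    change _ = runQuasimorphism φ α.1 y - runQuasimorphism φ α.1 (x * y)
      + runQuasimorphism φ α.1 x at h
    simp only [Matrix.cons_val_zero, Matrix.cons_val_one] at h
    linarith
  · simpa using hB fun _ => x

/-- The geometric sequence `n ↦ r ^ n`, for `r` in the open unit interval. -/
def geometric (r : Set.Ioo (0 : ℝ) 1) : boundedSequences :=
  ⟨fun n => (r : ℝ) ^ n, 1, fun n => by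
    rw [abs_pow, abs_of_pos r.2.1]
    exact pow_le_one₀ r.2.1.le r.2.2.le⟩

/-- Dedekind's independence of characters, for the additive monoid `ℕ`. -/
theorem linearIndependent_pow : LinearIndependent ℝ (fun (r : ℝ) (n : ℕ) => r ^ n) := by
  have h := (linearIndependent_monoidHom (Multiplicative ℕ) ℝ).comp (fun r : ℝ => powersHom ℝ r)
    (powersHom ℝ).injective
  exact h

theorem linearIndependent_runClass_geometric (hC : ∃ a, a ∉ C) (hD : ∃ b, b ∉ D) :
    LinearIndependent ℝ (fun r => runClass φ (geometric r)) := by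
  have hpow : LinearIndependent ℝ (fun (r : Set.Ioo (0 : ℝ) 1) (n : ℕ) => (r : ℝ) ^ n) :=
    linearIndependent_pow.comp _ Subtype.val_injective
  rw [linearIndependent_iff'] at hpow ⊢
  intro s c hc r hr
  have h0 : runClass φ (∑ r ∈ s, c r • geometric r) = 0 := by
    rw [map_sum, ← hc]
    exact Finset.sum_congr rfl fun r _ => map_smul _ _ _
  have h1 := eq_of_runClass_eq_zero φ hC hD _ h0
  have h2 : ∀ n : ℕ, ((∑ r ∈ s, c r • geometric r : boundedSequences) : ℕ → ℝ) n
      = ∑ r ∈ s, c r * (r : ℝ) ^ n := by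
    intro n
    rw [Submodule.coe_sum, Finset.sum_apply]
    rfl
  -- Constancy holds only from index 1 on, so consecutive terms are compared there: `r ^ (n + 1) - r
  -- ^ (n + 2) = r * (1 - r) * r ^ n`.
  have h3 := hpow s (fun r => c r * ((r : ℝ) * (1 - r))) (by
    funext n
    have e := (h1 n).trans (h1 (n + 1)).symm
    rw [h2, h2, ← sub_eq_zero, ← Finset.sum_sub_distrib] at e
    rw [Finset.sum_apply, Pi.zero_apply]
    refine Eq.trans ?_ e
    refine Finset.sum_congr rfl fun r _ => ?_
    simp only [Pi.smul_apply, smul_eq_mul]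
    ring) r hr
  have h4 : (r : ℝ) * (1 - r) ≠ 0 :=
    mul_ne_zero r.2.1.ne' (sub_pos.2 r.2.2).ne'
  exact (mul_eq_zero.1 h3).resolve_right h4

theorem continuum_le_rank (hC : ∃ a, a ∉ C) (hD : ∃ b, b ∉ D) :
    𝔠 ≤ Module.rank ℝ (Cohomology (HNNExtension A C D φ) 2) := by
  have h := (linearIndependent_runClass_geometric φ hC hD).cardinal_lift_le_rank
  rw [Cardinal.mk_Ioo_real zero_lt_one] at h
  simpa using h

/-- The cohomology is a quotient of a set of real functions on the countable set `Fin k → G`, and `𝔠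
^ ℵ₀ = 𝔠`. -/
theorem rank_cohomology_le_continuum (G : Type u) [Group G] [Countable G] (k : ℕ) :
    Module.rank ℝ (Cohomology G k) ≤ 𝔠 := by
  refine (rank_le_card ℝ _).trans ?_
  refine (Cardinal.mk_le_of_surjective (Submodule.mkQ_surjective _)).trans ?_
  refine (Cardinal.mk_subtype_le _).trans ?_
  rw [Cardinal.mk_arrow, Cardinal.mk_real, Cardinal.lift_continuum, Cardinal.lift_uzero]
  exact (Cardinal.power_le_power_left Cardinal.continuum_ne_zero Cardinal.mk_le_aleph0).trans_eq
    Cardinal.continuum_power_aleph0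

end BoundedCohomology

namespace HNNExtension

variable {A : Type u} [Group A] {C D : Subgroup A} (φ : C ≃* D)

theorem countable [Countable A] : Countable (HNNExtension A C D φ) := by
  have hs : Function.Surjective
      (fun x : A × List (ℤˣ × A) => (of x.1 * syllableProd φ x.2 : HNNExtension A C D φ)) := by
    intro g
    obtain ⟨a, l, -, h⟩ := exists_syllableProd_eq φ g
    exact ⟨(a, l), h.symm⟩
  exact hs.countable

end HNNExtension

theorem exists_notMem_of_two_le_card_quotient {A : Type u} [Group A] {C : Subgroup A}
    (h : 2 ≤ #(A ⧸ C)) : ∃ a, a ∉ C := by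
  by_contra! hc
  obtain rfl : C = ⊤ := (Subgroup.eq_top_iff' C).2 hc
  have : #(A ⧸ (⊤ : Subgroup A)) ≤ 1 := Cardinal.le_one_iff_subsingleton.2
    QuotientGroup.subsingleton_quotient_top
  exact absurd (h.trans this) (by norm_num)

theorem theorem2 {A : Type u} [Group A] (C D : Subgroup A) (φ : C ≃* D)
    (hC : 2 ≤ #(A ⧸ C)) (hD : 2 ≤ #(A ⧸ D)) :
    𝔠 ≤ Module.rank ℝ (BoundedCohomology.Cohomology (HNNExtension A C D φ) 2) ∧
    (Countable A →
      Module.rank ℝ (BoundedCohomology.Cohomology (HNNExtension A C D φ) 2) = 𝔠) := by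
  have h := BoundedCohomology.continuum_le_rank φ (exists_notMem_of_two_le_card_quotient hC)
    (exists_notMem_of_two_le_card_quotient hD)
  refine ⟨h, fun _ => le_antisymm ?_ h⟩
  have := HNNExtension.countable φ
  exact BoundedCohomology.rank_cohomology_le_continuum _ 2
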